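/- Let $\Omega\subset\mathbb{C}$ be an arbitrary open set, and let $\bar\partial$ denote the maximal (densely defined) operator in $L^2(\Omega)$ given by $\operatorname{Dom}(\bar\partial)=\{u\in L^2(\Omega): \partial u/\partial\bar z\in L^2(\Omega)\text{ in the sense of distributions}\}$ and $\bar\partial u=\partial u/\partial\bar z$, where $\partial/\partial\bar z=\frac12(\partial_x+i\,\partial_y)$. Let $\bar\partial^{*}$ be its Hilbert space adjoint. Then the following are equivalent: (i) the range of $\bar\partial$ is closed in $L^2(\Omega)$; (iv$'$) there is a constant $C>0$ such that for every $f\in L^2(\Omega)$ there is $v\in L^2(\Omega)$ with $\bar\partial v=f$ in the sense of distributions on $\Omega$ and $\|v\|_{L^2(\Omega)}\le C\|f\|_{L^2(\Omega)}$. In particular, if the range of $\bar\partial$ is closed, then $\bar\partial:\operatorname{Dom}(\bar\partial)\to L^2(\Omega)$ is surjective. Moreover, $\ker\bar\partial^{*}=\{0\}$ (for every open set $\Omega\subset\mathbb{C}$). -/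

import Mathlib

open MeasureTheory TopologicalSpace
open scoped Distributions

noncomputable section

namespace PlanarDbar

/-- The complex Hilbert space `L²(Ω)`, with respect to Lebesgue measure on `Ω ⊆ ℂ`. -/
abbrev L2 (Ω : Opens ℂ) : Type :=
  Lp ℂ 2 ((volume : Measure ℂ).restrict (Ω : Set ℂ))

/-- The Wirtinger derivative `∂φ/∂z̄ = (∂φ/∂x + i ∂φ/∂y) / 2` of a (real-differentiable) function
on the complex plane. -/
def wirtingerBar (φ : ℂ → ℂ) (z : ℂ) : ℂ :=
  (1 / 2 : ℂ) * (fderiv ℝ φ z 1 + Complex.I * fderiv ℝ φ z Complex.I)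

/-- `∂v/∂z̄ = f` in the sense of distributions on `Ω`: tested against every smooth complex-valued
function with compact support in `Ω`. -/
def HasDistribDbar (Ω : Opens ℂ) (v f : L2 Ω) : Prop :=
  ∀ φ : 𝓓(Ω, ℂ),
    ∫ z in (Ω : Set ℂ), v z * wirtingerBar φ z = -∫ z in (Ω : Set ℂ), f z * φ z

variable {Ω : Opens ℂ}

lemma continuous_wirtingerBar (φ : 𝓓(Ω, ℂ)) : Continuous (wirtingerBar φ) := by
  have h : Continuous (fderiv ℝ φ) := φ.contDiff.continuous_fderiv (by simp)
  unfold wirtingerBar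
  fun_prop

lemma hasCompactSupport_wirtingerBar (φ : 𝓓(Ω, ℂ)) : HasCompactSupport (wirtingerBar φ) := by
  refine (φ.hasCompactSupport.fderiv ℝ).mono' ?_
  intro z hz
  refine subset_closure ?_
  intro h
  apply hz
  simp [wirtingerBar, h]

lemma memLp_test {g : ℂ → ℂ} (hg : Continuous g) (hs : HasCompactSupport g) :
    MemLp g 2 (volume.restrict (Ω : Set ℂ)) :=
  (hg.memLp_of_hasCompactSupport hs).restrict _

lemma integrable_mul_test (v : L2 Ω) {g : ℂ → ℂ} (hg : Continuous g) (hs : HasCompactSupport g) :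
    Integrable (fun z => v z * g z) (volume.restrict (Ω : Set ℂ)) :=
  (Lp.memLp v).integrable_mul (memLp_test hg hs)

/-- The graph of the maximal operator `∂̄` in `L²(Ω)`: all pairs `(u, f)` in `L²(Ω) × L²(Ω)` with
`∂u/∂z̄ = f` in the sense of distributions. -/
def dbarGraph (Ω : Opens ℂ) : Submodule ℂ (L2 Ω × L2 Ω) where
  carrier := {p | HasDistribDbar Ω p.1 p.2}
  zero_mem' := by
    intro φ
    have h : ((0 : L2 Ω) : ℂ → ℂ) =ᵐ[volume.restrict (Ω : Set ℂ)] 0 := Lp.coeFn_zero _ _ _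
    have h1 : ∫ z in (Ω : Set ℂ), (0 : L2 Ω) z * wirtingerBar φ z = 0 :=
      integral_eq_zero_of_ae (by filter_upwards [h] with z hz; rw [hz, Pi.zero_apply, zero_mul])
    have h2 : ∫ z in (Ω : Set ℂ), (0 : L2 Ω) z * φ z = 0 :=
      integral_eq_zero_of_ae (by filter_upwards [h] with z hz; rw [hz, Pi.zero_apply, zero_mul])
    simp only [Prod.fst_zero, Prod.snd_zero, h1, h2, neg_zero]
  add_mem' := by
    intro p q hp hq φ
    have key : ∀ (a b : L2 Ω) {g : ℂ → ℂ}, Continuous g → HasCompactSupport g →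
        ∫ z in (Ω : Set ℂ), (a + b) z * g z =
          (∫ z in (Ω : Set ℂ), a z * g z) + ∫ z in (Ω : Set ℂ), b z * g z := by
      intro a b g hg hs
      rw [← integral_add (integrable_mul_test a hg hs) (integrable_mul_test b hg hs)]
      refine integral_congr_ae ?_
      filter_upwards [Lp.coeFn_add a b] with z hz
      rw [hz, Pi.add_apply, add_mul]
    simp only [Prod.fst_add, Prod.snd_add]
    rw [key _ _ (continuous_wirtingerBar φ) (hasCompactSupport_wirtingerBar φ),
      key _ _ φ.continuous φ.hasCompactSupport, hp φ, hq φ, neg_add]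
  smul_mem' := by
    intro c p hp φ
    have key : ∀ (a : L2 Ω) (g : ℂ → ℂ),
        ∫ z in (Ω : Set ℂ), (c • a) z * g z = c * ∫ z in (Ω : Set ℂ), a z * g z := by
      intro a g
      rw [← integral_const_mul]
      refine integral_congr_ae ?_
      filter_upwards [Lp.coeFn_smul c a] with z hz
      rw [hz, Pi.smul_apply, smul_eq_mul, mul_assoc]
    simp only [Prod.smul_fst, Prod.smul_snd]
    rw [key, key, hp φ, mul_neg]

/-- The maximal operator `∂̄` in `L²(Ω)`: its domain is the set of all `u ∈ L²(Ω)` whose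
distributional derivative `∂u/∂z̄` lies in `L²(Ω)`, and `∂̄ u = ∂u/∂z̄` there
(with `(0,1)`-forms identified with functions). -/
def dbar (Ω : Opens ℂ) : L2 Ω →ₗ.[ℂ] L2 Ω :=
  (dbarGraph Ω).toLinearPMap

/-- An element of `L²(Ω)` that annihilates all test functions is zero. -/
lemma eq_zero_of_integral_test (g : L2 Ω)
    (h : ∀ φ : 𝓓(Ω, ℂ), ∫ z in (Ω : Set ℂ), g z * φ z = 0) : g = 0 := by
  have hloc : LocallyIntegrableOn g (Ω : Set ℂ) volume := by
    have h1 : LocallyIntegrable g (volume.restrict (Ω : Set ℂ)) :=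
      (Lp.memLp g).locallyIntegrable (by norm_num)
    rw [locallyIntegrableOn_iff Ω.isOpen.isLocallyClosed]
    intro k hk hkc
    have := h1.integrableOn_isCompact hkc
    rwa [IntegrableOn, Measure.restrict_restrict_of_subset hk] at this
  have h0 : ∀ᵐ z ∂volume, z ∈ (Ω : Set ℂ) → g z = 0 := by
    refine Ω.isOpen.ae_eq_zero_of_integral_contDiff_smul_eq_zero hloc ?_
    intro ψ hψ hc hsub
    have hsupp : tsupport (fun z => (ψ z : ℂ)) ⊆ tsupport ψ := by
      refine closure_mono ?_
      intro z hz hz'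
      exact hz (by simp [hz'])
    let φ : 𝓓(Ω, ℂ) :=
      { toFun := fun z => (ψ z : ℂ)
        contDiff' := Complex.ofRealCLM.contDiff.comp hψ
        hasCompactSupport' := hc.comp_left Complex.ofReal_zero
        tsupport_subset' := hsupp.trans hsub }
    have h2 := h φ
    rw [← setIntegral_eq_integral_of_forall_compl_eq_zero (s := (Ω : Set ℂ)), ← h2]
    · refine integral_congr_ae (Filter.Eventually.of_forall fun z => ?_)
      change ψ z • g z = g z * (ψ z : ℂ)
      rw [Complex.real_smul, mul_comm]
    · intro z hz
      have : ψ z = 0 := by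
        by_contra hne
        exact hz (hsub (subset_closure hne))
      rw [this, zero_smul]
  refine Lp.ext ?_
  filter_upwards [(ae_restrict_iff' Ω.isOpen.measurableSet).2 h0,
    Lp.coeFn_zero ℂ 2 (volume.restrict (Ω : Set ℂ))] with z hz hz'
  rw [hz, hz', Pi.zero_apply]

/-- The distributional derivative is unique, so that `dbarGraph Ω` is the graph of an operator. -/
lemma dbarGraph_functional (p : L2 Ω × L2 Ω) (hp : p ∈ dbarGraph Ω) (h0 : p.1 = 0) : p.2 = 0 := by
  refine eq_zero_of_integral_test _ fun φ => ?_
  have h1 : ∫ z in (Ω : Set ℂ), p.1 z * wirtingerBar φ z = 0 := by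
    refine integral_eq_zero_of_ae ?_
    rw [h0]
    filter_upwards [Lp.coeFn_zero ℂ 2 (volume.restrict (Ω : Set ℂ))] with z hz
    rw [hz, Pi.zero_apply, zero_mul]
  have h2 := hp φ
  rw [h1] at h2
  exact neg_eq_zero.1 h2.symm

/-- The graph of the operator `dbar Ω`. -/
lemma mem_graph_dbar_iff (u f : L2 Ω) : (u, f) ∈ (dbar Ω).graph ↔ HasDistribDbar Ω u f := by
  rw [dbar, Submodule.toLinearPMap_graph_eq _ dbarGraph_functional]
  exact Iff.rfl

/-- The domain of the operator `dbar Ω`. -/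
lemma mem_domain_dbar_iff (u : L2 Ω) :
    u ∈ (dbar Ω).domain ↔ ∃ f : L2 Ω, HasDistribDbar Ω u f := by
  rw [LinearPMap.mem_domain_iff]
  exact exists_congr fun f => mem_graph_dbar_iff u f

/-- On test functions the distributional derivative is the classical one. -/
lemma hasDistribDbar_test (ψ : 𝓓(Ω, ℂ)) :
    HasDistribDbar Ω ((memLp_test ψ.continuous ψ.hasCompactSupport).toLp ψ)
      ((memLp_test (continuous_wirtingerBar ψ)
        (hasCompactSupport_wirtingerBar ψ)).toLp (wirtingerBar ψ)) := by
  intro φ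
  have e1 := (memLp_test (Ω := Ω) ψ.continuous ψ.hasCompactSupport).coeFn_toLp
  have e2 := (memLp_test (Ω := Ω) (continuous_wirtingerBar ψ)
        (hasCompactSupport_wirtingerBar ψ)).coeFn_toLp
  have hz : ∀ (χ : 𝓓(Ω, ℂ)) (z : ℂ), z ∉ (Ω : Set ℂ) → χ z = 0 := by
    intro χ z hz
    by_contra hne
    exact hz (χ.tsupport_subset (subset_closure hne))
  have i1 : ∫ z in (Ω : Set ℂ), ((memLp_test (Ω := Ω) ψ.continuous ψ.hasCompactSupport).toLp ψ) z
      * wirtingerBar φ z = ∫ z, ψ z * wirtingerBar φ z := by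
    rw [← setIntegral_eq_integral_of_forall_compl_eq_zero (s := (Ω : Set ℂ))
      (f := fun z => ψ z * wirtingerBar φ z) (fun z h => by simp [hz ψ z h])]
    refine integral_congr_ae ?_
    filter_upwards [e1] with z h
    rw [h]
  have i2 : ∫ z in (Ω : Set ℂ), ((memLp_test (Ω := Ω) (continuous_wirtingerBar ψ)
        (hasCompactSupport_wirtingerBar ψ)).toLp (wirtingerBar ψ)) z
      * φ z = ∫ z, wirtingerBar ψ z * φ z := by
    rw [← setIntegral_eq_integral_of_forall_compl_eq_zero (s := (Ω : Set ℂ))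
      (f := fun z => wirtingerBar ψ z * φ z) (fun z h => by simp [hz φ z h])]
    refine integral_congr_ae ?_
    filter_upwards [e2] with z h
    rw [h]
  rw [i1, i2]
  have hc : ∀ χ : 𝓓(Ω, ℂ), Continuous (fderiv ℝ χ) := fun χ =>
    χ.contDiff.continuous_fderiv (by simp)
  have hd : ∀ χ : 𝓓(Ω, ℂ), Differentiable ℝ χ := fun χ =>
    χ.contDiff.differentiable (by simp)
  have j1 : ∀ (χ η : 𝓓(Ω, ℂ)) (v : ℂ), Integrable (fun z => χ z * fderiv ℝ η z v) := by
    intro χ η v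
    have := hc η
    have hχ := χ.continuous
    exact Continuous.integrable_of_hasCompactSupport (by fun_prop) χ.hasCompactSupport.mul_right
  have j2 : ∀ (χ η : 𝓓(Ω, ℂ)) (v : ℂ), Integrable (fun z => fderiv ℝ η z v * χ z) := by
    intro χ η v
    simpa only [mul_comm] using j1 χ η v
  have j3 : Integrable (fun z => ψ z * φ z) := by
    have h1 := ψ.continuous
    have h2 := φ.continuous
    exact Continuous.integrable_of_hasCompactSupport (by fun_prop) ψ.hasCompactSupport.mul_right
  have parts : ∀ v : ℂ, ∫ z, ψ z * fderiv ℝ φ z v = -∫ z, fderiv ℝ ψ z v * φ z := fun v =>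
    integral_mul_fderiv_eq_neg_fderiv_mul_of_integrable (j2 φ ψ v) (j1 ψ φ v) j3 (fun z _ => hd ψ z)
      (fun z _ => hd φ z)
  have l1 : ∫ z, ψ z * wirtingerBar φ z = (1 / 2 : ℂ) * ((∫ z, ψ z * fderiv ℝ φ z 1) +
      Complex.I * ∫ z, ψ z * fderiv ℝ φ z Complex.I) := by
    rw [← integral_const_mul, ← integral_add (j1 _ _ _) ((j1 _ _ _).const_mul _),
      ← integral_const_mul]
    refine integral_congr_ae (Filter.Eventually.of_forall fun z => ?_)
    simp only [wirtingerBar]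
    ring
  have l2 : ∫ z, wirtingerBar ψ z * φ z = (1 / 2 : ℂ) * ((∫ z, fderiv ℝ ψ z 1 * φ z) +
      Complex.I * ∫ z, fderiv ℝ ψ z Complex.I * φ z) := by
    rw [← integral_const_mul, ← integral_add (j2 _ _ _) ((j2 _ _ _).const_mul _),
      ← integral_const_mul]
    refine integral_congr_ae (Filter.Eventually.of_forall fun z => ?_)
    simp only [wirtingerBar]
    ring
  rw [l1, l2, parts, parts]
  ring

/-- `dbar Ω` is densely defined, so that its Hilbert space adjoint is the usual one. -/
lemma dense_domain_dbar : Dense ((dbar Ω).domain : Set (L2 Ω)) := by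
  rw [Submodule.dense_iff_topologicalClosure_eq_top, Submodule.topologicalClosure_eq_top_iff,
    Submodule.eq_bot_iff]
  intro g hg
  have hstar : star g = 0 := by
    refine eq_zero_of_integral_test _ fun φ => ?_
    have hmem := (mem_domain_dbar_iff _).2 ⟨_, hasDistribDbar_test φ⟩
    have h := Submodule.inner_left_of_mem_orthogonal hmem hg
    rw [L2.inner_def] at h
    rw [← h]
    refine integral_congr_ae ?_
    filter_upwards [(memLp_test (Ω := Ω) φ.continuous φ.hasCompactSupport).coeFn_toLp,
      Lp.coeFn_star g] with z h1 h2
    rw [h1, h2]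
    simp [mul_comm]
  refine Lp.ext ?_
  filter_upwards [Lp.coeFn_star g, Lp.coeFn_zero ℂ 2 (volume.restrict (Ω : Set ℂ))] with z h1 h2
  rw [hstar, h2, Pi.star_apply] at h1
  rw [h2, Pi.zero_apply]
  exact star_eq_zero.1 h1.symm

end PlanarDbar

end

open MeasureTheory TopologicalSpace Filter
open scoped Distributions Convolution ComplexConjugate

namespace PlanarDbar

/-! ### A Liouville theorem for weakly holomorphic functions in L²(ℂ) -/

section WeakLiouville

variable {w g : ℂ → ℂ}

/-! The crux is that nothing nonzero is orthogonal to the range (`eq_zero_of_inner_dbar_eq_zero`).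
For such a v, extend its conjugate by zero to w in L²(ℂ). The restriction to Ω of any test function
on ℂ lies in the domain, whatever its values at the boundary, so w is weakly holomorphic on the
whole plane. Convolutions of w with test functions are then entire and bounded, hence constant by
Liouville; the constant is 0 because the L² mass of w near points drifting to infinity vanishes. So
w = 0, for every Ω.

This gives the trivial kernel of the adjoint, and it makes a closed range the whole space. The open
mapping theorem, applied to the second projection on the closed graph, then yields C. Conversely,
solvability for every f makes the range everything, hence closed. -/

lemma wirtingerBar_comp_const_sub (hg : Differentiable ℝ g) (x y : ℂ) :
    wirtingerBar (fun t => g (x - t)) y = -wirtingerBar g (x - y) := by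
  have h : HasFDerivAt (fun t => g (x - t)) ((fderiv ℝ g (x - y)).comp
      (-ContinuousLinearMap.id ℝ ℂ)) y :=
    (hg (x - y)).hasFDerivAt.comp y ((hasFDerivAt_id y).const_sub x)
  simp only [wirtingerBar, h.fderiv, ContinuousLinearMap.comp_apply, neg_apply,
    ContinuousLinearMap.id_apply, map_neg]
  ring

lemma hasCompactSupport_comp_const_sub (hs : HasCompactSupport g) (x : ℂ) :
    HasCompactSupport fun t => g (x - t) :=
  hs.comp_homeomorph (Homeomorph.subLeft x)

/-- Convolving a weakly holomorphic function with a test function gives an entire function. -/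
lemma differentiable_convolution_of_weakly_holomorphic (hw : LocallyIntegrable w)
    (h : ∀ φ : ℂ → ℂ, ContDiff ℝ (⊤ : ℕ∞) φ → HasCompactSupport φ →
      ∫ z, w z * wirtingerBar φ z = 0)
    (hg : ContDiff ℝ (⊤ : ℕ∞) g) (hs : HasCompactSupport g) :
    Differentiable ℂ (w ⋆[ContinuousLinearMap.mul ℝ ℂ] g) := by
  intro x
  have hg1 : ContDiff ℝ 1 g := hg.of_le (by norm_cast)
  have hd := hs.hasFDerivAt_convolution_right (ContinuousLinearMap.mul ℝ ℂ) hw hg1 x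
  have hgd : Differentiable ℝ g := hg1.differentiable (by simp)
  have hcont : Continuous (fderiv ℝ g) := hg1.continuous_fderiv one_ne_zero
  have hint : ∀ v : ℂ, Integrable fun t => w t * fderiv ℝ g (x - t) v := fun v =>
    ((hs.fderiv_apply ℝ v).convolutionExists_right (ContinuousLinearMap.mul ℝ ℂ) hw
      (by fun_prop) x)
  have hval : ∀ v : ℂ, fderiv ℝ (w ⋆[ContinuousLinearMap.mul ℝ ℂ] g) x v =
      ∫ t, w t * fderiv ℝ g (x - t) v := by
    intro v
    rw [hd.fderiv, convolution_precompR_apply _ hw (hs.fderiv ℝ) hcont]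
    rfl
  refine differentiableAt_complex_iff_differentiableAt_real.2 ⟨hd.differentiableAt, ?_⟩
  -- The reflected translate of `g` is itself a test function, so the hypothesis says that the ∂/∂z̄
  -- derivative of the convolution vanishes at `x`.
  have h0 := h _ (hg.comp (contDiff_const.sub contDiff_id))
    (hasCompactSupport_comp_const_sub hs x)
  have hsum : (∫ t, w t * fderiv ℝ g (x - t) 1) +
      Complex.I * ∫ t, w t * fderiv ℝ g (x - t) Complex.I = 0 := by
    rw [← integral_const_mul, ← integral_add (hint 1) ((hint _).const_mul _)]
    have h1 : ∫ t, (-2 : ℂ) * (w t * wirtingerBar (fun s => g (x - s)) t) = 0 := by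
      rw [integral_const_mul]
      exact mul_eq_zero_of_right _ h0
    rw [← h1]
    refine integral_congr_ae (Eventually.of_forall fun t => ?_)
    simp only [wirtingerBar_comp_const_sub hgd]
    simp only [wirtingerBar]
    ring
  -- The Cauchy–Riemann equation, obtained from `hsum` using I² = -1.
  rw [hval, hval, smul_eq_mul, eq_neg_of_add_eq_zero_left hsum]
  linear_combination (∫ t, w t * fderiv ℝ g (x - t) Complex.I) * Complex.I_sq

/-- The convolution of an `L²` function with a continuous function supported in a ball is
controlled by the `L²` mass of the former near the point. -/
lemma norm_convolution_le_of_support_subset_closedBall (hw : MemLp w 2) (hg : Continuous g)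
    (hs : HasCompactSupport g) {R : ℝ} (hR : Function.support g ⊆ Metric.closedBall 0 R)
    (x : ℂ) {t : ℝ} (ht : 0 < t) :
    2 * ‖(w ⋆[ContinuousLinearMap.mul ℝ ℂ] g) x‖ ≤
      t * (∫ y, (Metric.closedBall x R).indicator (fun y => ‖w y‖ ^ 2) y) +
        t⁻¹ * ∫ y, ‖g y‖ ^ 2 := by
  have hw2 : Integrable fun y => ‖w y‖ ^ 2 := hw.integrable_norm_pow two_ne_zero
  have hg2 : Integrable fun y => ‖g (x - y)‖ ^ 2 :=
    (((hg.memLp_of_hasCompactSupport hs (p := 2)).integrable_norm_pow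
      two_ne_zero).comp_sub_left x)
  have hi1 := (hw2.indicator (Metric.isClosed_closedBall (x := x) (ε := R)).measurableSet)
  rw [← integral_sub_left_eq_self (fun y => ‖g y‖ ^ 2) volume x, ← integral_const_mul t,
    ← integral_const_mul t⁻¹, ← integral_add (hi1.const_mul _) (hg2.const_mul _), convolution_def]
  calc 2 * ‖∫ y, w y * g (x - y)‖ ≤ 2 * ∫ y, ‖w y * g (x - y)‖ := by
        gcongr
        exact norm_integral_le_integral_norm _
    _ = ∫ y, 2 * ‖w y * g (x - y)‖ := (integral_const_mul _ _).symm
    _ ≤ _ := by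
        refine integral_mono_of_nonneg (Eventually.of_forall fun y => by positivity)
          ((hi1.const_mul _).add (hg2.const_mul _)) (Eventually.of_forall fun y => ?_)
        by_cases hy : g (x - y) = 0
        · simp only [hy, mul_zero, norm_zero]
          refine add_nonneg (mul_nonneg ht.le (Set.indicator_nonneg (fun _ _ => by positivity) _))
            (by simp)
        · have hmem : y ∈ Metric.closedBall x R := by
            have := hR hy
            rwa [mem_closedBall_zero_iff, ← dist_eq_norm, dist_comm] at this
          simp only [Set.indicator_of_mem hmem, norm_mul]
          -- Weighted AM–GM replaces Cauchy–Schwarz; the weight `t` stays free for a later limit.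
          have key : t * ‖w y‖ ^ 2 + t⁻¹ * ‖g (x - y)‖ ^ 2 - 2 * (‖w y‖ * ‖g (x - y)‖) =
              t⁻¹ * (t * ‖w y‖ - ‖g (x - y)‖) ^ 2 := by
            field_simp
            ring
          have : 0 ≤ t⁻¹ * (t * ‖w y‖ - ‖g (x - y)‖) ^ 2 := by positivity
          linarith

/-- The mass of an integrable function in balls drifting to infinity tends to zero. -/
lemma tendsto_integral_indicator_closedBall_natCast {f : ℂ → ℝ} (hf : Integrable f) (R : ℝ) :
    Tendsto (fun n : ℕ => ∫ y, (Metric.closedBall (n : ℂ) R).indicator f y) atTop (nhds 0) := by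
  rw [← integral_zero ℂ ℝ (μ := volume)]
  refine tendsto_integral_of_dominated_convergence (fun y => ‖f y‖)
    (fun n => (hf.indicator Metric.isClosed_closedBall.measurableSet).aestronglyMeasurable) hf.norm
    (fun n => Eventually.of_forall fun y => norm_indicator_le_norm_self f y)
    (Eventually.of_forall fun y => ?_)
  refine tendsto_const_nhds.congr' ?_
  filter_upwards [eventually_gt_atTop ⌈‖y‖ + R⌉₊] with n hn
  rw [Set.indicator_of_notMem]
  intro hy
  rw [Metric.mem_closedBall, dist_comm, dist_eq_norm] at hy
  have h1 : ‖y‖ + R < n := Nat.lt_of_ceil_lt hn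
  have h2 := norm_sub_norm_le (n : ℂ) y
  rw [Complex.norm_natCast] at h2
  linarith

/-- A weakly holomorphic function in `L²(ℂ)` annihilates all test functions. -/
lemma integral_mul_eq_zero_of_weakly_holomorphic (hw : MemLp w 2)
    (h : ∀ φ : ℂ → ℂ, ContDiff ℝ (⊤ : ℕ∞) φ → HasCompactSupport φ →
      ∫ z, w z * wirtingerBar φ z = 0)
    {φ : ℂ → ℂ} (hφ : ContDiff ℝ (⊤ : ℕ∞) φ) (hs : HasCompactSupport φ) :
    ∫ z, w z * φ z = 0 := by
  -- The reflection makes `F 0` equal to the integral of `w * φ`.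
  let g : ℂ → ℂ := fun y => φ (0 - y)
  have hg : ContDiff ℝ (⊤ : ℕ∞) g := hφ.comp (contDiff_const.sub contDiff_id)
  have hgs : HasCompactSupport g := hasCompactSupport_comp_const_sub hs 0
  let F : ℂ → ℂ := w ⋆[ContinuousLinearMap.mul ℝ ℂ] g
  have hF : Differentiable ℂ F :=
    differentiable_convolution_of_weakly_holomorphic (hw.locallyIntegrable (by norm_num)) h hg hgs
  obtain ⟨R, hR⟩ := hgs.isCompact.isBounded.subset_closedBall 0
  have hest := fun (x : ℂ) (t : ℝ) (ht : 0 < t) =>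
    norm_convolution_le_of_support_subset_closedBall hw hg.continuous hgs
      ((subset_tsupport g).trans hR) x ht
  have hw2 : Integrable fun y => ‖w y‖ ^ 2 := hw.integrable_norm_pow two_ne_zero
  have hconst : ∀ x, F x = F 0 := by
    refine fun x => hF.apply_eq_apply_of_bounded ?_ x 0
    refine isBounded_iff_forall_norm_le.2
      ⟨(∫ y, ‖w y‖ ^ 2) + ∫ y, ‖g y‖ ^ 2, ?_⟩
    rintro _ ⟨x, rfl⟩
    have h1 := hest x 1 one_pos
    have h2 : ∫ y, (Metric.closedBall x R).indicator (fun y => ‖w y‖ ^ 2) y ≤ ∫ y, ‖w y‖ ^ 2 :=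
      integral_mono (hw2.indicator Metric.isClosed_closedBall.measurableSet) hw2
        (Set.indicator_le_self' fun _ _ => by positivity)
    rw [inv_one, one_mul, one_mul] at h1
    have h3 : ‖F x‖ = ‖(w ⋆[ContinuousLinearMap.mul ℝ ℂ] g) x‖ := rfl
    linarith [norm_nonneg (F x)]
  -- Since F 0 = F n, letting n → ∞ at fixed `t` removes the local mass of `w`; only afterwards does
  -- t → ∞ remove the other term.
  have hle : ∀ t : ℝ, 0 < t → 2 * ‖F 0‖ ≤ t⁻¹ * ∫ y, ‖g y‖ ^ 2 := by
    intro t ht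
    have hlim := ((tendsto_integral_indicator_closedBall_natCast hw2 R).const_mul t).add_const
      (t⁻¹ * ∫ y, ‖g y‖ ^ 2)
    rw [mul_zero, zero_add] at hlim
    refine ge_of_tendsto' hlim fun n => ?_
    rw [← hconst n]
    exact hest n t ht
  have hzero : 2 * ‖F 0‖ ≤ 0 := by
    have hlim := (tendsto_inv_atTop_zero (𝕜 := ℝ)).mul_const (∫ y, ‖g y‖ ^ 2)
    rw [zero_mul] at hlim
    refine ge_of_tendsto hlim ?_
    filter_upwards [eventually_gt_atTop 0] with t ht using hle t ht
  have hF0 : F 0 = 0 := norm_eq_zero.1 (by linarith [norm_nonneg (F 0)])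
  rw [← hF0]
  simp only [F, convolution_def, g, zero_sub, neg_neg, ContinuousLinearMap.mul_apply']

end WeakLiouville

/-! ### Triviality of the orthogonal complement of the range -/

variable {Ω : Opens ℂ}

/-- A test function on a smaller open set, viewed as a test function on the whole plane. -/
noncomputable def extendTest (φ : 𝓓(Ω, ℂ)) : 𝓓((⊤ : Opens ℂ), ℂ) where
  toFun := φ
  contDiff' := φ.contDiff
  hasCompactSupport' := φ.hasCompactSupport
  tsupport_subset' := fun _ _ => trivial

/-- Test functions on the whole plane restrict to elements of the domain of `dbar Ω`. -/
lemma hasDistribDbar_restrict_test (ψ : 𝓓((⊤ : Opens ℂ), ℂ)) :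
    HasDistribDbar Ω ((memLp_test ψ.continuous ψ.hasCompactSupport).toLp ψ)
      ((memLp_test (continuous_wirtingerBar ψ)
        (hasCompactSupport_wirtingerBar ψ)).toLp (wirtingerBar ψ)) := by
  intro φ
  have hφ : ∀ z ∉ (Ω : Set ℂ), φ z = 0 := fun z hz =>
    image_eq_zero_of_notMem_tsupport fun h => hz (φ.tsupport_subset h)
  have hwφ : ∀ z ∉ (Ω : Set ℂ), wirtingerBar φ z = 0 := fun z hz => by
    have : fderiv ℝ φ z = 0 := image_eq_zero_of_notMem_tsupport fun h =>
      hz (φ.tsupport_subset (tsupport_fderiv_subset ℝ h))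
    simp [wirtingerBar, this]
  have key : ∀ (U : Opens ℂ) {a b : ℂ → ℂ} (ha : MemLp a 2 (volume.restrict (U : Set ℂ))),
      (∀ z ∉ (U : Set ℂ), b z = 0) →
      ∫ z in (U : Set ℂ), ha.toLp a z * b z = ∫ z, a z * b z := by
    intro U a b ha hb
    rw [← setIntegral_eq_integral_of_forall_compl_eq_zero (s := (U : Set ℂ))
      (f := fun z => a z * b z) (fun z h => by simp [hb z h])]
    refine integral_congr_ae ?_
    filter_upwards [ha.coeFn_toLp] with z h
    rw [h]
  -- Integration by parts on ℂ suffices: the factor from `φ` vanishes off Ω, so `ψ` need not.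
  have h := hasDistribDbar_test ψ (extendTest φ)
  rw [key _ _ fun z hz => (hz (Opens.mem_top z)).elim, key _ _ fun z hz => (hz (Opens.mem_top z)).elim] at h
  rw [key _ _ hwφ, key _ _ hφ]
  exact h

/-- Only the zero function is orthogonal to the range of `dbar Ω`. -/
lemma eq_zero_of_inner_dbar_eq_zero (v : L2 Ω)
    (hv : ∀ u f : L2 Ω, HasDistribDbar Ω u f → inner ℂ v f = 0) : v = 0 := by
  have hΩ : MeasurableSet (Ω : Set ℂ) := Ω.isOpen.measurableSet
  let w : ℂ → ℂ := (Ω : Set ℂ).indicator fun z => conj (v z)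
  have hw : MemLp w 2 := (memLp_indicator_iff_restrict hΩ).2 (Lp.memLp v).star
  have hint : ∀ b : ℂ → ℂ, ∫ z, w z * b z = ∫ z in (Ω : Set ℂ), conj (v z) * b z := by
    intro b
    rw [← integral_indicator hΩ]
    refine integral_congr_ae (Eventually.of_forall fun z => ?_)
    simp only [w, Set.indicator_mul_left]
  have hweak : ∀ φ : ℂ → ℂ, ContDiff ℝ (⊤ : ℕ∞) φ → HasCompactSupport φ →
      ∫ z, w z * wirtingerBar φ z = 0 := by
    intro φ hφ hs
    let ψ : 𝓓((⊤ : Opens ℂ), ℂ) := ⟨φ, hφ, hs, fun _ _ => trivial⟩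
    have h := hv _ _ (hasDistribDbar_restrict_test ψ)
    rw [L2.inner_def] at h
    rw [hint, ← h]
    refine integral_congr_ae ?_
    filter_upwards [(memLp_test (Ω := Ω) (continuous_wirtingerBar ψ)
      (hasCompactSupport_wirtingerBar ψ)).coeFn_toLp] with z hz
    rw [hz, RCLike.inner_apply, mul_comm]
    rfl
  have hstar : star v = 0 := by
    refine eq_zero_of_integral_test _ fun φ => ?_
    rw [← integral_mul_eq_zero_of_weakly_holomorphic hw hweak φ.contDiff φ.hasCompactSupport, hint]
    refine integral_congr_ae ?_
    filter_upwards [Lp.coeFn_star v] with z hz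
    rw [hz]
    rfl
  refine Lp.ext ?_
  filter_upwards [Lp.coeFn_star v, Lp.coeFn_zero ℂ 2 (volume.restrict (Ω : Set ℂ))] with z h1 h2
  rw [hstar, h2, Pi.star_apply] at h1
  rw [h2, Pi.zero_apply]
  exact star_eq_zero.1 h1.symm

lemma hasDistribDbar_dbar (u : (dbar Ω).domain) : HasDistribDbar Ω u (dbar Ω u) :=
  (mem_graph_dbar_iff _ _).1 ((dbar Ω).mem_graph u)

lemma exists_dbar_eq {u f : L2 Ω} (h : HasDistribDbar Ω u f) :
    ∃ x : (dbar Ω).domain, (x : L2 Ω) = u ∧ dbar Ω x = f :=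
  (LinearPMap.mem_graph_iff _).1 ((mem_graph_dbar_iff u f).2 h)

/-- If the range of `dbar Ω` is closed, then `dbar Ω` is surjective. -/
lemma surjective_dbar_of_isClosed_range (h : IsClosed (Set.range (dbar Ω))) :
    Function.Surjective (dbar Ω) := by
  have hcl : IsClosed ((LinearMap.range (dbar Ω).toFun : Submodule ℂ (L2 Ω)) : Set (L2 Ω)) := h
  have htop : LinearMap.range (dbar Ω).toFun = ⊤ := by
    rw [← hcl.submodule_topologicalClosure_eq, Submodule.topologicalClosure_eq_top_iff,
      Submodule.eq_bot_iff]
    intro v hv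
    refine eq_zero_of_inner_dbar_eq_zero v fun u f huf => ?_
    obtain ⟨x, -, rfl⟩ := exists_dbar_eq huf
    exact Submodule.inner_left_of_mem_orthogonal (LinearMap.mem_range_self _ x) hv
  exact LinearMap.range_eq_top.1 htop

/-! ### Closed graph and open mapping -/

/-- The pairing of an `L²` function with an `L²` function depends continuously on the former. -/
lemma continuous_integral_mul {b : ℂ → ℂ} (hb : MemLp b 2 (volume.restrict (Ω : Set ℂ))) :
    Continuous fun a : L2 Ω => ∫ z in (Ω : Set ℂ), a z * b z := by
  have h : (fun a : L2 Ω => ∫ z in (Ω : Set ℂ), a z * b z) =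
      fun a : L2 Ω => inner ℂ (star (hb.toLp b)) a := by
    funext a
    rw [L2.inner_def]
    refine integral_congr_ae ?_
    filter_upwards [hb.coeFn_toLp, Lp.coeFn_star (hb.toLp b)] with z h1 h2
    rw [h2, Pi.star_apply, h1]
    simp
  rw [h]
  fun_prop

/-- The maximal operator `dbar Ω` is closed. -/
lemma isClosed_dbarGraph : IsClosed (dbarGraph Ω : Set (L2 Ω × L2 Ω)) := by
  have h : (dbarGraph Ω : Set (L2 Ω × L2 Ω)) = ⋂ φ : 𝓓(Ω, ℂ), {p |
      ∫ z in (Ω : Set ℂ), p.1 z * wirtingerBar φ z = -∫ z in (Ω : Set ℂ), p.2 z * φ z} := by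
    ext p
    simp only [Set.mem_iInter]
    rfl
  rw [h]
  refine isClosed_iInter fun φ => isClosed_eq ?_ ?_
  · exact (continuous_integral_mul (memLp_test (continuous_wirtingerBar φ)
      (hasCompactSupport_wirtingerBar φ))).comp continuous_fst
  · exact ((continuous_integral_mul (memLp_test φ.continuous φ.hasCompactSupport)).comp
      continuous_snd).neg

/-- If `dbar Ω` is surjective, then `∂v/∂z̄ = f` can be solved with a norm estimate. -/
lemma exists_norm_le_of_surjective_dbar (h : Function.Surjective (dbar Ω)) :
    ∃ C : ℝ, 0 < C ∧ ∀ f : L2 Ω, ∃ v : L2 Ω, HasDistribDbar Ω v f ∧ ‖v‖ ≤ C * ‖f‖ := by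
  have : CompleteSpace (dbarGraph Ω) := isClosed_dbarGraph.completeSpace_coe
  let T : dbarGraph Ω →L[ℂ] L2 Ω :=
    (ContinuousLinearMap.snd ℂ (L2 Ω) (L2 Ω)).comp (dbarGraph Ω).subtypeL
  have hT : Function.Surjective T := by
    intro f
    obtain ⟨u, rfl⟩ := h f
    exact ⟨⟨(u, dbar Ω u), hasDistribDbar_dbar u⟩, rfl⟩
  obtain ⟨C, hC, hb⟩ := T.exists_preimage_norm_le hT
  refine ⟨C, hC, fun f => ?_⟩
  obtain ⟨p, rfl, hp⟩ := hb f
  -- The product carries the sup norm, so the graph-norm bound already controls the first component.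
  exact ⟨p.1.1, p.2, (norm_fst_le p.1).trans hp⟩

end PlanarDbar

theorem mainTheorem6 (Ω : TopologicalSpace.Opens ℂ) :
    (IsClosed (Set.range (PlanarDbar.dbar Ω)) ↔
      ∃ C : ℝ, 0 < C ∧ ∀ f : PlanarDbar.L2 Ω, ∃ v : PlanarDbar.L2 Ω,
        PlanarDbar.HasDistribDbar Ω v f ∧ ‖v‖ ≤ C * ‖f‖) ∧
    (IsClosed (Set.range (PlanarDbar.dbar Ω)) →
      Function.Surjective (PlanarDbar.dbar Ω)) ∧
    (∀ v : (PlanarDbar.dbar Ω).adjoint.domain, (PlanarDbar.dbar Ω).adjoint v = 0 → v = 0) := by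

  refine ⟨⟨fun h => PlanarDbar.exists_norm_le_of_surjective_dbar
    (PlanarDbar.surjective_dbar_of_isClosed_range h), ?_⟩,
    PlanarDbar.surjective_dbar_of_isClosed_range, ?_⟩
  · rintro ⟨C, -, h⟩
    have hsurj : Function.Surjective (PlanarDbar.dbar Ω) := fun f => by
      obtain ⟨v, hv, -⟩ := h f
      obtain ⟨x, -, hx⟩ := PlanarDbar.exists_dbar_eq hv
      exact ⟨x, hx⟩
    rw [hsurj.range_eq]
    exact isClosed_univ
  · intro v hv
    refine Subtype.ext (PlanarDbar.eq_zero_of_inner_dbar_eq_zero _ fun u f huf => ?_)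
    obtain ⟨x, -, rfl⟩ := PlanarDbar.exists_dbar_eq huf
    rw [← (PlanarDbar.dbar Ω).adjoint_isFormalAdjoint PlanarDbar.dense_domain_dbar v x, hv,
      inner_zero_left]
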